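/- A (finite-dimensional) system consists of a finite-dimensional real vector space $A$, a closed convex cone $A_+\subseteq A$ that linearly generates $A$ and contains no nontrivial subspace, and an element $u$ of the interior of the dual cone $A^*_+=\{f\in A^* : f\ge 0 \text{ on } A_+\}$. States are the elements of $\Omega=\{x\in A_+ : u(x)=1\}$; pure states are the extreme points of $\Omega$; effects are the $e\in A^*_+$ with $0\le e\le 1$ on $\Omega$; a measurement is a finite family of effects with sum $u$. States $\omega_1,\dots,\omega_N$ are perfectly distinguishable, and a measurement $(e_1,\dots,e_N)$ distinguishes them, if $e_i(\omega_j)=\delta_{ij}$. The system satisfies * Unique Spectrality, if every state $\omega$ can be written as $\omega=\sum_{i=1}^N p_i\omega_i$ with $p_i\ge 0$, $\sum_i p_i=1$ and $\omega_1,\dots,\omega_N$ perfectly distinguishable pure states, and any two such decompositions of $\omega$ with all weights positive have the same weights up to a permutation; * Projectivity, if every face of $\Omega$ has the form $\Omega\cap\operatorname{im}P$ for a filter $P$. Here a filter is a linear map $P:A\to A$ with $P^2=P$, $PA_+\subseteq A_+$ and $u(Px)\le u(x)$ for $x\in A_+$, such that both $P$ (with respect to $A_+$) and its adjoint $P^*$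 (with respect to $A^*_+$) are complemented. A projection $P$ preserving a cone $C$ is complemented if there is a linear projection $P'$ preserving $C$ with $C\cap\operatorname{im}P=C\cap\ker P'$ and $C\cap\ker P=C\cap\operatorname{im}P'$; * Symmetry of Transition Probabilities, if $\widetilde\omega(\sigma)=\widetilde\sigma(\omega)$ for all pure states $\omega,\sigma$. Here an effect is atomic if it spans an extremal ray of $A^*_+$ and is the largest effect on that ray, and $\widetilde\omega$ is the atomic effect with $\widetilde\omega(\omega)=1$ (which, in a system satisfying Projectivity, exists and is unique for every pure state $\omega$). A measurement is fine-grained if each of its effects is a scalar multiple of an atomic effect. A spectral measurement on a state $\omega$ is a measurement $(f_1,\dots,f_N)$ that distinguishes the states $\omega_1,\dots,\omega_N$ of some decomposition $\omega=\sum_{i=1}^N p_i\omega_i$ with $p_i\ge0$, $\sum_i p_i=1$ and $\omega_i$ perfectly distinguishable pure states. For real vectors $x,y$ of length $n$, $x$ is majorized by $y$ if $\sum_{i=1}^k x^\downarrow_i\le\sum_{i=1}^k y^\downarrow_i$ for $k<n$, with equality for $k=n$, where $\downarrow$ denotes decreasing rearrangement; vectors of different lengths are compared after padding the shorter one with zeros.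 Theorem. Let a finite-dimensional system satisfy Unique Spectrality, Projectivity and Symmetry of Transition Probabilities, and let $\omega$ be a state. Then spectral measurements on $\omega$ exist, and for every fine-grained measurement $e_1,\dots,e_n$ the vector $[e_1(\omega),\dots,e_n(\omega)]$ of outcome probabilities is majorized by the vector $[f_1(\omega),\dots,f_N(\omega)]$ of outcome probabilities of any spectral measurement on $\omega$; equivalently, it is majorized by the weights $(p_1,\dots,p_N)$ of any decomposition $\omega=\sum_i p_i\omega_i$ into perfectly distinguishable pure states. -/

import Mathlib

/-! ### Cones -/

/-- The dual cone `{f | f x ≥ 0 for all x ∈ C}`, inside the space of (continuous) linear functionals.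
In finite dimension every linear functional is continuous. -/
def dualCone {V : Type*} [NormedAddCommGroup V] [NormedSpace ℝ V] (C : PointedCone ℝ V) :
    PointedCone ℝ (StrongDual ℝ V) :=
  PointedCone.dual (topDualPairing ℝ V).flip (C : Set V)

/-- The nonzero vector `x ∈ C` spans an extremal ray of the cone `C`: whenever `x` is a sum of two
elements of `C`, both lie on the ray `ℝ₊ x`. -/
def SpansExtremalRay {E : Type*} [AddCommGroup E] [Module ℝ E] (C : PointedCone ℝ E) (x : E) :
    Prop :=
  x ∈ C ∧ x ≠ 0 ∧ ∀ a ∈ C, ∀ b ∈ C, a + b = x →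
    (∃ s : ℝ, 0 ≤ s ∧ a = s • x) ∧ (∃ t : ℝ, 0 ≤ t ∧ b = t • x)

/-- A positive linear projection: `P C ⊆ C` and `P² = P`. -/
def IsPositiveProjection {E : Type*} [NormedAddCommGroup E] [NormedSpace ℝ E]
    (C : PointedCone ℝ E) (P : E →L[ℝ] E) : Prop :=
  (∀ x ∈ C, P x ∈ C) ∧ ∀ x, P (P x) = P x

/-- `P` and `Q` are complementary: `im P ∩ C = ker Q ∩ C` and `ker P ∩ C = im Q ∩ C`. -/
def AreComplementary {E : Type*} [NormedAddCommGroup E] [NormedSpace ℝ E]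
    (C : PointedCone ℝ E) (P Q : E →L[ℝ] E) : Prop :=
  {x : E | x ∈ C ∧ x ∈ Set.range P} = {x : E | x ∈ C ∧ Q x = 0} ∧
  {x : E | x ∈ C ∧ P x = 0} = {x : E | x ∈ C ∧ x ∈ Set.range Q}

/-- `P` is complemented: it has a complementary positive projection. -/
def HasComplementaryProjection {E : Type*} [NormedAddCommGroup E] [NormedSpace ℝ E]
    (C : PointedCone ℝ E) (P : E →L[ℝ] E) : Prop :=
  ∃ Q : E →L[ℝ] E, IsPositiveProjection C Q ∧ AreComplementary C P Q

/-! ### Systems, states and measurements -/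

/-- A system: a regular cone (closed, generating, containing no nontrivial subspace) in a
finite-dimensional real vector space `V`, with an order unit `unit` in the interior of the dual
cone.  All functionals in the dual cone that are bounded by `1` on normalized states count as
effects.  The norm of `V` serves only to provide the topology of `V`. -/
structure GPTSystem (V : Type*) [NormedAddCommGroup V] [NormedSpace ℝ V]
    [FiniteDimensional ℝ V] where
  cone : PointedCone ℝ V
  isClosed_cone : IsClosed (cone : Set V)
  span_cone : Submodule.span ℝ (cone : Set V) = ⊤
  salient_cone : (cone : ConvexCone ℝ V).Salient
  unit : StrongDual ℝ V
  unit_mem_interior : unit ∈ interior (dualCone cone : Set (StrongDual ℝ V))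

namespace GPTSystem

variable {V : Type*} [NormedAddCommGroup V] [NormedSpace ℝ V] [FiniteDimensional ℝ V]

/-- The set `Ω` of normalized states. -/
def states (A : GPTSystem V) : Set V := {x | x ∈ A.cone ∧ A.unit x = 1}

/-- The pure states: the extreme points of `Ω`. -/
def pureStates (A : GPTSystem V) : Set V := A.states.extremePoints ℝ

/-- Effects: functionals in the dual cone with values in `[0, 1]` on normalized states. -/
def IsEffect (A : GPTSystem V) (e : StrongDual ℝ V) : Prop :=
  e ∈ dualCone A.cone ∧ ∀ x ∈ A.states, 0 ≤ e x ∧ e x ≤ 1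

/-- A measurement: finitely many effects that add up to the unit. -/
def IsMeasurement (A : GPTSystem V) {n : ℕ} (e : Fin n → StrongDual ℝ V) : Prop :=
  (∀ i, A.IsEffect (e i)) ∧ ∑ i, e i = A.unit

/-- The measurement `e` perfectly distinguishes the family `σ`: `e i (σ j) = δ i j`. -/
def Distinguishes (A : GPTSystem V) {n : ℕ} (e : Fin n → StrongDual ℝ V) (σ : Fin n → V) :
    Prop :=
  A.IsMeasurement e ∧ ∀ i j, e i (σ j) = if i = j then 1 else 0

/-- `ω = ∑ i, p i • σ i` is a convex decomposition into perfectly distinguishable pure states. -/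
def IsSpectralDecomposition (A : GPTSystem V) (ω : V) {n : ℕ} (p : Fin n → ℝ) (σ : Fin n → V) :
    Prop :=
  (∀ i, 0 ≤ p i) ∧ ∑ i, p i = 1 ∧ (∀ i, σ i ∈ A.pureStates) ∧
  (∃ e : Fin n → StrongDual ℝ V, A.Distinguishes e σ) ∧ ω = ∑ i, p i • σ i

/-- A spectral measurement on `ω`: one that distinguishes the pure states of a convex decomposition
of `ω` into perfectly distinguishable pure states. -/
def IsSpectralMeasurement (A : GPTSystem V) (ω : V) {n : ℕ} (f : Fin n → StrongDual ℝ V) : Prop :=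
  ∃ (p : Fin n → ℝ) (σ : Fin n → V), A.IsSpectralDecomposition ω p σ ∧ A.Distinguishes f σ

/-- Unique Spectrality: every state has a decomposition into perfectly distinguishable pure states,
and any two such decompositions with positive weights have the same weights up to a permutation
(in particular, the same number of them). -/
def UniqueSpectrality (A : GPTSystem V) : Prop :=
  (∀ ω ∈ A.states, ∃ (n : ℕ) (p : Fin n → ℝ) (σ : Fin n → V), A.IsSpectralDecomposition ω p σ) ∧
  ∀ ω ∈ A.states, ∀ (n m : ℕ) (p : Fin n → ℝ) (σ : Fin n → V) (q : Fin m → ℝ) (ρ : Fin m → V),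
    A.IsSpectralDecomposition ω p σ → (∀ i, 0 < p i) →
    A.IsSpectralDecomposition ω q ρ → (∀ i, 0 < q i) →
    ∃ τ : Fin m ≃ Fin n, ∀ i, p (τ i) = q i

/-! ### Projectivity -/

/-- A filter: a normalized positive linear projection that is complemented and whose adjoint
`f ↦ f ∘ P` is complemented with respect to the dual cone. -/
def IsFilter (A : GPTSystem V) (P : V →L[ℝ] V) : Prop :=
  IsPositiveProjection A.cone P ∧ (∀ x ∈ A.cone, A.unit (P x) ≤ A.unit x) ∧
  HasComplementaryProjection A.cone P ∧
  HasComplementaryProjection (dualCone A.cone) (ContinuousLinearMap.precomp ℝ P)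

/-- A face of the convex set `Ω`. -/
def IsFace (A : GPTSystem V) (F : Set V) : Prop := Convex ℝ F ∧ IsExtreme ℝ A.states F

/-- Projectivity: each face of `Ω` is the set of normalized states in the image of a filter. -/
def Projectivity (A : GPTSystem V) : Prop :=
  ∀ F : Set V, A.IsFace F → ∃ P : V →L[ℝ] V, A.IsFilter P ∧ F = Set.range P ∩ A.states

/-! ### Atomic effects and transition probabilities -/

/-- An atomic effect: it spans an extremal ray of the dual cone and is the largest effect on that
ray. -/
def IsAtomic (A : GPTSystem V) (e : StrongDual ℝ V) : Prop :=
  SpansExtremalRay (dualCone A.cone) e ∧ A.IsEffect e ∧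
  ∀ c : ℝ, 0 ≤ c → A.IsEffect (c • e) → c ≤ 1

/-- Symmetry of Transition Probabilities: `ω̃ σ = σ̃ ω` for pure states `ω`, `σ`, where `ω̃` is the
atomic effect with `ω̃ ω = 1` (in a projective system it exists and is unique). -/
def SymmetryOfTransitionProbabilities (A : GPTSystem V) : Prop :=
  ∀ ω ∈ A.pureStates, ∀ σ ∈ A.pureStates, ∀ a b : StrongDual ℝ V,
    A.IsAtomic a → a ω = 1 → A.IsAtomic b → b σ = 1 → a σ = b ω

/-- A fine-grained measurement: all effects are multiples of atomic effects. -/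
def IsFineGrained (A : GPTSystem V) {n : ℕ} (e : Fin n → StrongDual ℝ V) : Prop :=
  A.IsMeasurement e ∧ ∀ i, ∃ (c : ℝ) (a : StrongDual ℝ V), A.IsAtomic a ∧ e i = c • a

end GPTSystem

/-! ### Majorization -/

/-- The decreasing rearrangement of a real vector. -/
noncomputable def decreasingRearrangement {n : ℕ} (x : Fin n → ℝ) : Fin n → ℝ :=
  fun i => x (Tuple.sort x (Fin.rev i))

/-- `x ≺ y` for vectors of the same length: the partial sums of the decreasing rearrangement of `x`
are at most those of `y`, with equality for the total sums. -/
def MajorizedBySameLength {n : ℕ} (x y : Fin n → ℝ) : Prop :=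
  (∀ k < n, ∑ i : Fin n with i.val < k, decreasingRearrangement x i ≤
    ∑ i : Fin n with i.val < k, decreasingRearrangement y i) ∧
  ∑ i, decreasingRearrangement x i = ∑ i, decreasingRearrangement y i

/-- Padding a vector with zeros up to length `N`. -/
noncomputable def padZeros {n : ℕ} (N : ℕ) (x : Fin n → ℝ) : Fin N → ℝ :=
  fun i => if h : i.val < n then x ⟨i.val, h⟩ else 0

/-- `x ≺ y` for vectors of arbitrary finite lengths: pad the shorter one with zeros. -/
def MajorizedBy {m n : ℕ} (x : Fin m → ℝ) (y : Fin n → ℝ) : Prop :=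
  MajorizedBySameLength (padZeros (max m n) x) (padZeros (max m n) y)

/-!
Let `ω = ∑ i, p i • σ i` be a decomposition into perfectly distinguishable pure states and let
`e j = c j • a j` be a fine-grained measurement, with `a j` atomic. The outcome probabilities are
`e j ω = ∑ i, M j i * p i` with `M j i = e j (σ i)`, and it suffices that the nonnegative matrix `M`
has column sums `1` and row sums at most `1` (`majorizedBy_of_matrix`): the sum of the `k` largest
outcome probabilities is then a combination of the weights `p i` with coefficients in `[0, 1]` of
total at most `k`.

The column sums are `1` because `e` is a measurement. For the row sums, `a j` attains the value `1`
at a pure state `ρ` (`IsAtomic.exists_pureState`), and symmetry of transition probabilities gives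
`a j (σ i) = b i ρ` for any atomic effect `b i` with `b i (σ i) = 1`. Projectivity, applied to the
face `{σ i}`, gives such an atomic effect which is moreover the least effect with value `1` at
`σ i` (`Projectivity.exists_isAtomic`). Comparing with a measurement that distinguishes the `σ i`,
one gets `∑ i, b i ≤ unit`, so that the `j`-th row sum is at most `c j ≤ 1`.
-/

/-! ### Majorization by substochastic matrices -/

theorem sum_padZeros {n N : ℕ} (h : n ≤ N) (x : Fin n → ℝ) :
    ∑ i, padZeros N x i = ∑ i, x i := by
  rw [Finset.sum_fin_eq_sum_range x,
    show ∑ i, padZeros N x i = _ from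
      Fin.sum_univ_eq_sum_range (fun k => if h : k < n then x ⟨k, h⟩ else 0) N]
  refine (Finset.sum_subset (Finset.range_mono h) fun k _ hk => ?_).symm
  rw [dif_neg (by simpa using hk)]

theorem padZeros_nonneg {n : ℕ} (N : ℕ) {x : Fin n → ℝ} (hx : ∀ i, 0 ≤ x i) (i : Fin N) :
    0 ≤ padZeros N x i := by
  unfold padZeros
  split_ifs
  exacts [hx _, le_rfl]

theorem sum_decreasingRearrangement {N : ℕ} (x : Fin N → ℝ) :
    ∑ i, decreasingRearrangement x i = ∑ i, x i :=
  Equiv.sum_comp (Fin.revPerm.trans (Tuple.sort x)) x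

theorem antitone_decreasingRearrangement {N : ℕ} (x : Fin N → ℝ) :
    Antitone (decreasingRearrangement x) := fun _ _ h =>
  Tuple.monotone_sort x (Fin.rev_le_rev.mpr h)

/-- Weights in `[0, 1]` of total at most `k` give a nonnegative vector a weighted sum that is at
most the sum of its `k` largest entries. -/
theorem sum_mul_le_sum_decreasingRearrangement {N : ℕ} {y w : Fin N → ℝ} (hy : ∀ i, 0 ≤ y i)
    (hw0 : ∀ i, 0 ≤ w i) (hw1 : ∀ i, w i ≤ 1) {k : ℕ} (hk : k < N) (hw : ∑ i, w i ≤ k) :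
    ∑ i, w i * y i ≤ ∑ i : Fin N with i.val < k, decreasingRearrangement y i := by
  set τ : Equiv.Perm (Fin N) := Fin.revPerm.trans (Tuple.sort y)
  have hτ : ∀ i, decreasingRearrangement y i = y (τ i) := fun _ => rfl
  have hanti := antitone_decreasingRearrangement y
  -- Shifting `y` by its `(k + 1)`-st largest entry `t` separates the first `k` entries by sign.
  set t : ℝ := decreasingRearrangement y ⟨k, hk⟩
  have ht : 0 ≤ t := hy _
  have hcard : (Finset.univ.filter fun i : Fin N => i.val < k).card = k := by
    rw [Fin.card_filter_val_lt]; omega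
  have key : ∑ i, w (τ i) * (y (τ i) - t) ≤
      ∑ i : Fin N with i.val < k, (decreasingRearrangement y i - t) := by
    rw [Finset.sum_filter]
    refine Finset.sum_le_sum fun i _ => ?_
    split_ifs with hi
    · have h1 : t ≤ y (τ i) := hanti (show i ≤ ⟨k, hk⟩ from hi.le)
      rw [hτ]
      nlinarith [hw1 (τ i)]
    · have h1 : y (τ i) ≤ t := hanti (show (⟨k, hk⟩ : Fin N) ≤ i from not_lt.mp hi)
      nlinarith [hw0 (τ i)]
  rw [Equiv.sum_comp τ fun i => w i * (y i - t), Finset.sum_sub_distrib, Finset.sum_const, hcard,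
    nsmul_eq_mul] at key
  simp only [mul_sub, Finset.sum_sub_distrib, ← Finset.sum_mul] at key
  nlinarith

theorem majorizedBySameLength_of_matrix {N : ℕ} {M : Fin N → Fin N → ℝ} {x y : Fin N → ℝ}
    (hM : ∀ j i, 0 ≤ M j i) (hcol : ∀ i, ∑ j, M j i ≤ 1) (hrow : ∀ j, ∑ i, M j i ≤ 1)
    (hy : ∀ i, 0 ≤ y i) (hx : ∀ j, x j = ∑ i, M j i * y i) (hsum : ∑ j, x j = ∑ i, y i) :
    MajorizedBySameLength x y := by
  refine ⟨fun k hk => ?_, by rw [sum_decreasingRearrangement, sum_decreasingRearrangement, hsum]⟩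
  set τ : Equiv.Perm (Fin N) := Fin.revPerm.trans (Tuple.sort x)
  have hτ : ∀ i, decreasingRearrangement x i = x (τ i) := fun _ => rfl
  have hcard : (Finset.univ.filter fun i : Fin N => i.val < k).card = k := by
    rw [Fin.card_filter_val_lt]; omega
  calc ∑ i : Fin N with i.val < k, decreasingRearrangement x i
      = ∑ i, (∑ j : Fin N with j.val < k, M (τ j) i) * y i := by
        simp only [hτ, hx, Finset.sum_mul]
        exact Finset.sum_comm
    _ ≤ _ := by
      refine sum_mul_le_sum_decreasingRearrangement hy
        (fun i => Finset.sum_nonneg fun j _ => hM _ _) (fun i => ?_) hk ?_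
      · refine le_trans (Finset.sum_le_sum_of_subset_of_nonneg (Finset.filter_subset _ _)
          fun j _ _ => hM _ _) ?_
        rw [Equiv.sum_comp τ fun j => M j i]
        exact hcol i
      · rw [Finset.sum_comm]
        refine (Finset.sum_le_card_nsmul _ _ 1 fun j _ => hrow _).trans ?_
        rw [hcard, nsmul_eq_mul, mul_one]

theorem majorizedBy_of_matrix {m n : ℕ} {M : Fin m → Fin n → ℝ} {x : Fin m → ℝ} {y : Fin n → ℝ}
    (hM : ∀ j i, 0 ≤ M j i) (hcol : ∀ i, ∑ j, M j i = 1) (hrow : ∀ j, ∑ i, M j i ≤ 1)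
    (hy : ∀ i, 0 ≤ y i) (hx : ∀ j, x j = ∑ i, M j i * y i) : MajorizedBy x y := by
  have hm : m ≤ max m n := le_max_left _ _
  have hn : n ≤ max m n := le_max_right _ _
  unfold MajorizedBy
  generalize max m n = N at hm hn
  refine majorizedBySameLength_of_matrix
    (M := fun j => padZeros N fun i => padZeros N (fun j => M j i) j)
    (fun j => padZeros_nonneg N fun i => padZeros_nonneg N (fun j => hM j i) j)
    (fun i => ?_) (fun j => ?_) (padZeros_nonneg N hy) (fun j => ?_) ?_
  · by_cases hi : i.val < n
    · have : ∀ j, padZeros N (fun i => padZeros N (fun j => M j i) j) i =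
          padZeros N (fun j => M j ⟨i, hi⟩) j := fun j => by
        rw [padZeros, dif_pos hi]
      simp only [this, sum_padZeros hm, hcol, le_refl]
    · simp [padZeros, hi]
  · rw [sum_padZeros hn]
    by_cases hj : j.val < m
    · simpa [padZeros, hj] using hrow ⟨j, hj⟩
    · simp [padZeros, hj]
  · have : ∀ i, padZeros N (fun i => padZeros N (fun j => M j i) j) i * padZeros N y i =
        padZeros N (fun i => padZeros N (fun j => M j i) j * y i) i := fun i => by
      by_cases hi : i.val < n <;> simp [padZeros, hi]
    simp only [this, sum_padZeros hn]
    by_cases hj : j.val < m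
    · simpa [padZeros, hj] using hx ⟨j, hj⟩
    · simp [padZeros, hj]
  · simp only [sum_padZeros hm, sum_padZeros hn, hx]
    rw [Finset.sum_comm]
    simp only [← Finset.sum_mul, hcol, one_mul]

/-! ### The state space -/

theorem mem_dualCone {V : Type*} [NormedAddCommGroup V] [NormedSpace ℝ V] {C : PointedCone ℝ V}
    {f : StrongDual ℝ V} : f ∈ dualCone C ↔ ∀ x ∈ C, 0 ≤ f x :=
  Iff.rfl

namespace GPTSystem

variable {V : Type*} [NormedAddCommGroup V] [NormedSpace ℝ V] [FiniteDimensional ℝ V]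
  {A : GPTSystem V}

theorem isClosed_states (A : GPTSystem V) : IsClosed A.states :=
  A.isClosed_cone.inter (isClosed_singleton.preimage A.unit.continuous)

/-- An interior point of the dual cone is bounded below by a multiple of the norm. -/
theorem exists_norm_le_unit (A : GPTSystem V) :
    ∃ ε > 0, ∀ x ∈ A.cone, ε * ‖x‖ ≤ A.unit x := by
  obtain ⟨ε, hε, hball⟩ := Metric.mem_nhds_iff.mp (mem_interior_iff_mem_nhds.mp A.unit_mem_interior)
  refine ⟨ε / 2, half_pos hε, fun x hx => ?_⟩
  obtain ⟨g, hg, hgx⟩ := exists_dual_vector'' ℝ x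
  have hmem : A.unit - (ε / 2) • g ∈ dualCone A.cone := by
    apply hball
    rw [mem_ball_iff_norm, sub_sub_cancel_left, norm_neg, norm_smul,
      Real.norm_of_nonneg (by linarith)]
    nlinarith
  have := mem_dualCone.mp hmem x hx
  simp only [sub_apply, smul_apply, hgx, smul_eq_mul,
    RCLike.ofReal_real_eq_id, id_eq] at this
  linarith

theorem isCompact_states (A : GPTSystem V) : IsCompact A.states := by
  obtain ⟨ε, hε, h⟩ := A.exists_norm_le_unit
  refine Metric.isCompact_of_isClosed_isBounded A.isClosed_states
    (isBounded_iff_forall_norm_le.mpr ⟨1 / ε, fun x hx => ?_⟩)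
  rw [le_div_iff₀' hε, ← hx.2]
  exact h x hx.1

theorem unit_nonneg (A : GPTSystem V) {x : V} (hx : x ∈ A.cone) : 0 ≤ A.unit x :=
  mem_dualCone.mp (interior_subset A.unit_mem_interior) x hx

theorem eq_zero_of_unit_eq_zero (A : GPTSystem V) {x : V} (hx : x ∈ A.cone) (h : A.unit x = 0) :
    x = 0 := by
  obtain ⟨ε, hε, hle⟩ := A.exists_norm_le_unit
  have := hle x hx
  rw [h] at this
  exact norm_le_zero_iff.mp (by nlinarith [norm_nonneg x])

theorem exists_eq_smul_state (A : GPTSystem V) {x : V} (hx : x ∈ A.cone) (h : x ≠ 0) :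
    ∃ y ∈ A.states, x = A.unit x • y := by
  have hu : A.unit x ≠ 0 := fun h0 => h (A.eq_zero_of_unit_eq_zero hx h0)
  refine ⟨(A.unit x)⁻¹ • x, ⟨A.cone.smul_mem (inv_nonneg.mpr (A.unit_nonneg hx)) hx, ?_⟩, ?_⟩
  · rw [map_smul, smul_eq_mul, inv_mul_cancel₀ hu]
  · rw [smul_inv_smul₀ hu]

theorem mem_dualCone_of_states {f : StrongDual ℝ V} (h : ∀ x ∈ A.states, 0 ≤ f x) :
    f ∈ dualCone A.cone := by
  refine mem_dualCone.mpr fun x hx => ?_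
  by_cases h0 : x = 0
  · simp [h0]
  · obtain ⟨y, hy, hxy⟩ := A.exists_eq_smul_state hx h0
    rw [hxy, map_smul]
    exact mul_nonneg (A.unit_nonneg hx) (h y hy)

theorem ext_of_cone {W : Type*} [NormedAddCommGroup W] [NormedSpace ℝ W] {f g : V →L[ℝ] W}
    (h : ∀ x ∈ A.cone, f x = g x) : f = g :=
  ContinuousLinearMap.coe_injective (LinearMap.ext_on A.span_cone h)

theorem eq_zero_of_dualCone {f : StrongDual ℝ V} (hf : f ∈ dualCone A.cone)
    (hf' : -f ∈ dualCone A.cone) : f = 0 :=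
  ext_of_cone fun x hx => le_antisymm (by simpa using mem_dualCone.mp hf' x hx)
    (mem_dualCone.mp hf x hx)

/-! ### Atomic effects -/

theorem IsEffect.unit_sub {e : StrongDual ℝ V} (he : A.IsEffect e) :
    A.unit - e ∈ dualCone A.cone :=
  mem_dualCone_of_states fun x hx => by
    simpa [hx.2] using (he.2 x hx).2

/-- An atomic effect attains the value `1` at a pure state. -/
theorem IsAtomic.exists_pureState {a : StrongDual ℝ V} (ha : A.IsAtomic a)
    (hne : A.states.Nonempty) : ∃ ρ ∈ A.pureStates, a ρ = 1 := by
  have hexp : IsExposed ℝ A.states (a.toExposed A.states) := ContinuousLinearMap.toExposed.isExposed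
  obtain ⟨x, hx, hmax⟩ := A.isCompact_states.exists_isMaxOn hne a.continuous.continuousOn
  -- The maximum of `a` is attained at an extreme point of the face where it is attained.
  obtain ⟨ρ, hρ⟩ := (hexp.isCompact A.isCompact_states).extremePoints_nonempty ⟨x, hx, hmax⟩
  have hρmax : ∀ y ∈ A.states, a y ≤ a ρ := hρ.1.2
  have hρs : ρ ∈ A.states := hρ.1.1
  refine ⟨ρ, hexp.isExtreme.extremePoints_subset_extremePoints hρ, ?_⟩
  have hpos : 0 < a ρ := by
    refine lt_of_le_of_ne (ha.2.1.2 ρ hρs).1 fun h0 => ha.1.2.1 ?_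
    refine eq_zero_of_dualCone ha.1.1 (mem_dualCone_of_states fun y hy => ?_)
    have := hρmax y hy
    simp only [neg_apply]
    linarith
  have hscale : A.IsEffect ((a ρ)⁻¹ • a) := by
    have h : ∀ y ∈ A.states, 0 ≤ ((a ρ)⁻¹ • a) y ∧ ((a ρ)⁻¹ • a) y ≤ 1 := fun y hy => by
      rw [smul_apply, smul_eq_mul]
      refine ⟨mul_nonneg (inv_nonneg.mpr hpos.le) (ha.2.1.2 y hy).1, ?_⟩
      rw [inv_mul_le_one₀ hpos]
      exact hρmax y hy
    exact ⟨mem_dualCone_of_states fun y hy => (h y hy).1, h⟩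
  have h1 := ha.2.2 _ (inv_nonneg.mpr hpos.le) hscale
  exact le_antisymm (ha.2.1.2 ρ hρs).2 ((inv_le_one₀ hpos).mp h1)

/-- In a projective system, the filter of a pure state `ω` has the form `x ↦ b x • ω`, where `b` is
an atomic effect with `b ω = 1`. The complement of its adjoint shows that `b` is below every effect
with value `1` at `ω`. -/
theorem Projectivity.exists_isAtomic (hP : A.Projectivity) {ω : V} (hω : ω ∈ A.pureStates) :
    ∃ b, A.IsAtomic b ∧ b ω = 1 ∧ ∀ e, A.IsEffect e → e ω = 1 → e - b ∈ dualCone A.cone := by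
  obtain ⟨P, ⟨⟨hpos, hproj⟩, hle, -, Q, ⟨hQpos, hQproj⟩, him, hker⟩, hF⟩ :=
    hP {ω} ⟨convex_singleton ω, isExtreme_singleton.mpr hω⟩
  have hωs : ω ∈ A.states := hω.1
  have hPω : P ω = ω := by
    obtain ⟨y, hy⟩ : ω ∈ Set.range P := (hF ▸ Set.mem_singleton ω : ω ∈ Set.range P ∩ _).1
    rw [← hy, hproj]
  set b : StrongDual ℝ V := A.unit.comp P
  have hb : ∀ x, b x = A.unit (P x) := fun _ => rfl
  have hbω : b ω = 1 := by rw [hb, hPω, hωs.2]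
  -- On the cone, the normalization of `P x` is a state in the image of `P`, which is `ω`.
  have hPeq : P = b.smulRight ω := ext_of_cone fun x hx => by
    rw [ContinuousLinearMap.smulRight_apply, hb]
    by_cases h0 : P x = 0
    · simp [h0]
    · obtain ⟨y, hy, hxy⟩ := A.exists_eq_smul_state (hpos x hx) h0
      have hu : A.unit (P x) ≠ 0 := fun h => h0 (by rw [hxy, h, zero_smul])
      have hyω : y ∈ ({ω} : Set V) := by
        rw [hF]
        refine ⟨⟨(A.unit (P x))⁻¹ • x, ?_⟩, hy⟩
        rw [map_smul]
        nth_rewrite 2 [hxy]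
        rw [inv_smul_smul₀ hu]
      rw [← Set.mem_singleton_iff.mp hyω]
      exact hxy
  have hadj : ∀ f : StrongDual ℝ V, ContinuousLinearMap.precomp ℝ P f = f ω • b := fun f => by
    ext x
    have : P x = b x • ω := by
      conv_lhs => rw [hPeq]
      rfl
    simp [this, mul_comm]
  have hbeff : A.IsEffect b := by
    have h : ∀ x ∈ A.states, 0 ≤ b x ∧ b x ≤ 1 := fun x hx =>
      ⟨A.unit_nonneg (hpos x hx.1), (hle x hx.1).trans_eq hx.2⟩
    exact ⟨mem_dualCone_of_states fun x hx => (h x hx).1, h⟩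
  have hkerQ : ∀ f ∈ dualCone A.cone, Q f = 0 → f = f ω • b := fun f hf hQf => by
    obtain ⟨g, hg⟩ := (him.symm ▸ ⟨hf, hQf⟩ :
      f ∈ {x | x ∈ dualCone A.cone ∧ x ∈ Set.range (ContinuousLinearMap.precomp ℝ P)}).2
    rw [← hg, hadj]
    simp [hbω]
  have hQb : Q b = 0 :=
    (him ▸ ⟨hbeff.1, A.unit, rfl⟩ : b ∈ {x | x ∈ dualCone A.cone ∧ Q x = 0}).2
  -- Functionals in the dual cone that vanish at `ω` are fixed by `Q`.
  have hQfix : ∀ f ∈ dualCone A.cone, f ω = 0 → Q f = f := fun f hf hfω => by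
    obtain ⟨g, hg⟩ := (hker ▸ ⟨hf, by rw [hadj, hfω, zero_smul]⟩ :
      f ∈ {x | x ∈ dualCone A.cone ∧ x ∈ Set.range Q}).2
    rw [← hg, hQproj]
  -- Both summands of `b` lie in the kernel of `Q`, which meets the dual cone in the ray of `b`.
  have hfst : ∀ f ∈ dualCone A.cone, ∀ g ∈ dualCone A.cone, f + g = b →
      ∃ s : ℝ, 0 ≤ s ∧ f = s • b := fun f hf g hg hfg => by
    refine ⟨f ω, mem_dualCone.mp hf ω hωs.1, hkerQ f hf (eq_zero_of_dualCone (hQpos f hf) ?_)⟩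
    have : Q f + Q g = 0 := by rw [← map_add, hfg, hQb]
    rw [neg_eq_of_add_eq_zero_right this]
    exact hQpos g hg
  refine ⟨b, ⟨⟨hbeff.1, fun h => by simp [h] at hbω, fun f hf g hg hfg =>
    ⟨hfst f hf g hg hfg, hfst g hg f hf (by rw [add_comm, hfg])⟩⟩, hbeff, fun c _ hc => ?_⟩,
    hbω, fun e he heω => ?_⟩
  · simpa [hbω] using (hc.2 ω hωs).2
  · -- As `Q` fixes `unit - e` and `unit - b` and kills `b`, it maps `e` to `e - b`.
    have h1 := hQfix _ he.unit_sub (by simp [heω, hωs.2])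
    have h2 := hQfix _ hbeff.unit_sub (by simp [hbω, hωs.2])
    rw [map_sub] at h1 h2
    rw [hQb, sub_zero] at h2
    have h3 : e - b = Q e := by
      rw [h2] at h1
      rw [← sub_eq_zero] at h1 ⊢
      rw [← h1]
      abel
    rw [h3]
    exact hQpos e he.1

/-! ### Fine-grained and spectral measurements -/

theorem Distinguishes.apply_eq_weight {ω : V} {n : ℕ} {p : Fin n → ℝ} {σ : Fin n → V}
    {f : Fin n → StrongDual ℝ V} (hf : A.Distinguishes f σ)
    (hd : A.IsSpectralDecomposition ω p σ) (j : Fin n) : f j ω = p j := by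
  rw [hd.2.2.2.2]
  simp [hf.2]

/-- By symmetry, `a (σ i)` is the value at `ρ` of the least effect with value `1` at `σ i`, hence at
most `f i ρ`; and the probabilities `f i ρ` add up to `1`. -/
theorem IsAtomic.sum_apply_le_one (hP : A.Projectivity)
    (hSTP : A.SymmetryOfTransitionProbabilities) {a : StrongDual ℝ V} (ha : A.IsAtomic a)
    {ρ : V} (hρ : ρ ∈ A.pureStates) (haρ : a ρ = 1) {n : ℕ} {σ : Fin n → V}
    (hσ : ∀ i, σ i ∈ A.pureStates) {f : Fin n → StrongDual ℝ V} (hf : A.Distinguishes f σ) :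
    ∑ i, a (σ i) ≤ 1 := by
  have hle : ∀ i, a (σ i) ≤ f i ρ := fun i => by
    obtain ⟨b, hb, hbσ, hmin⟩ := hP.exists_isAtomic (hσ i)
    rw [hSTP ρ hρ (σ i) (hσ i) a b ha haρ hb hbσ]
    have := mem_dualCone.mp (hmin (f i) (hf.1.1 i) (by simp [hf.2])) ρ hρ.1.1
    simpa using this
  calc ∑ i, a (σ i) ≤ ∑ i, f i ρ := Finset.sum_le_sum fun i _ => hle i
    _ = (∑ i, f i) ρ := by simp
    _ = 1 := by rw [hf.1.2, hρ.1.2]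

theorem IsFineGrained.majorizedBy_weights (hP : A.Projectivity)
    (hSTP : A.SymmetryOfTransitionProbabilities) {ω : V} (hω : ω ∈ A.states) {m : ℕ}
    {e : Fin m → StrongDual ℝ V} (he : A.IsFineGrained e) {n : ℕ} {p : Fin n → ℝ}
    {σ : Fin n → V} (hd : A.IsSpectralDecomposition ω p σ) :
    MajorizedBy (fun j => e j ω) p := by
  obtain ⟨hp, -, hσ, ⟨f, hf⟩, hsum⟩ := hd
  refine majorizedBy_of_matrix (M := fun j i => e j (σ i))
    (fun j i => ((he.1.1 j).2 _ (hσ i).1).1) (fun i => ?_) (fun j => ?_) hp (fun j => ?_)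
  · calc ∑ j, e j (σ i) = (∑ j, e j) (σ i) := by simp
      _ = 1 := by rw [he.1.2, (hσ i).1.2]
  · obtain ⟨c, a, ha, hca⟩ := he.2 j
    obtain ⟨ρ, hρ, haρ⟩ := ha.exists_pureState ⟨ω, hω⟩
    -- The factor `c` is the value of the effect `e j` at `ρ`, so it lies in `[0, 1]`.
    have hc := (he.1.1 j).2 ρ hρ.1
    simp only [hca, smul_apply, haρ, smul_eq_mul, mul_one] at hc
    simp only [hca, smul_apply, smul_eq_mul, ← Finset.mul_sum]
    exact mul_le_one₀ hc.2 (Finset.sum_nonneg fun i _ => (ha.2.1.2 _ (hσ i).1).1)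
      (ha.sum_apply_le_one hP hSTP hρ haρ hσ hf)
  · rw [hsum]
    simp [mul_comm]

end GPTSystem

theorem mainTheorem1 {V : Type*} [NormedAddCommGroup V] [NormedSpace ℝ V] [FiniteDimensional ℝ V]
    (A : GPTSystem V) (hS : A.UniqueSpectrality) (hP : A.Projectivity)
    (hSTP : A.SymmetryOfTransitionProbabilities)
    (ω : V) (hω : ω ∈ A.states) :
    -- spectral measurements on `ω` exist
    (∃ (n : ℕ) (f : Fin n → StrongDual ℝ V), A.IsSpectralMeasurement ω f) ∧
    ∀ (m : ℕ) (e : Fin m → StrongDual ℝ V), A.IsFineGrained e →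
      -- the outcome probabilities of `e` are majorized by those of any spectral measurement
      (∀ (n : ℕ) (f : Fin n → StrongDual ℝ V), A.IsSpectralMeasurement ω f →
        MajorizedBy (fun i => e i ω) (fun j => f j ω)) ∧
      -- and by the weights of any decomposition into perfectly distinguishable pure states
      (∀ (n : ℕ) (p : Fin n → ℝ) (σ : Fin n → V), A.IsSpectralDecomposition ω p σ →
        MajorizedBy (fun i => e i ω) p) := by
  refine ⟨?_, fun m e he => ⟨?_, fun n p σ hd => he.majorizedBy_weights hP hSTP hω hd⟩⟩
  · obtain ⟨n, p, σ, hd⟩ := hS.1 ω hω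
    obtain ⟨f, hf⟩ := hd.2.2.2.1
    exact ⟨n, f, p, σ, hd, hf⟩
  · rintro n f ⟨p, σ, hd, hf⟩
    simpa only [hf.apply_eq_weight hd] using he.majorizedBy_weights hP hSTP hω hd
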